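/- **Setting.** Fix $d\ge 3$. A model consists of a nonempty set $B$ (bodies), a set $Q$ (quantities) with operations $+,\cdot$ and an ordering $<$, unary relations $\mathrm{IOb}$ (inertial observers) and $\mathrm{Ph}$ (photons) on $B$, and a worldview relation $W\subseteq B\times B\times Q^d$; $W(m,b,p)$ reads "$m$ coordinatizes body $b$ at $p$". For $p\in Q^d$ put $p_\tau=p_1$, $p_\sigma=\langle p_2,\dots,p_d\rangle$, $|p|=\sqrt{p_1^2+\dots+p_d^2}$ (and likewise for shorter tuples), $o=\langle 0,\dots,0\rangle$, $1_t=\langle 1,0,\dots,0\rangle$. For observers $m,k$ and a body $b$ put $$\mathrm{ev}_m(p)=\{b: W(m,b,p)\},\qquad \mathrm{wl}_m(b)=\{p: W(m,b,p)\},\qquad Cd_m=\{p:\mathrm{ev}_m(p)\ne\emptyset\},\qquad Ev_m=\{\mathrm{ev}_m(p): p\in Cd_m\}.$$ $Crd_m(e)$ is the unique $q$ with $\mathrm{ev}_m(q)=e$; $\mathrm{time}_m(e)=Crd_m(e)_\tau$ and $\mathrm{time}_m(e_1,e_2)=|\mathrm{time}_m(e_1)-\mathrm{time}_m(e_2)|$;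 $w^k_m(q)$ is the unique $p\in Cd_m$ with $q\in Cd_k$ and $\mathrm{ev}_k(q)=\mathrm{ev}_m(p)$; and $1^k_m=w^k_m(1_t)-w^k_m(o)$. Whenever one of these values is written, its existence and uniqueness are part of the assertion. Put ${}^\ddag p=p$ if $p_\tau\ge0$ and ${}^\ddag p=-p$ otherwise; the Minkowski sphere of $m$ is $MS^\ddag_m=\{{}^\ddag 1^k_m: k\in \mathrm{IOb}\}$. Write $\mathrm{Bw}(p,q,r)$ if $p\neq r$ and $q=\lambda p+(1-\lambda)r$ for some $0<\lambda<1$. A set $H\subseteq Q^d$ is *convex* if for all $p,q,r\in H$ such that $\mathrm{Bw}(p,\mu q,r)$ for some $\mu\in Q$, there is such a $\mu$ with $\mu>1$; it is *nontrivial* if $\mathrm{Bw}(p,\mu q,r)$ for some $p,q,r\in H$ and $\mu>0$. **Axioms.** * AxEOF: $\langle Q;+,\cdot,<\rangle$ is a linearly ordered field in which positive elements have square roots. * AxSelf: for all $m\in\mathrm{IOb}$ and $p\in Q^d$: $W(m,m,p)\iff p_\sigma=o$. * AxPh: for all $m\in\mathrm{IOb}$ and $p,q\in Q^d$: $|p_\sigma-q_\sigma|=|p_\tau-q_\tau|\iff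 \mathrm{Ph}\cap \mathrm{ev}_m(p)\cap \mathrm{ev}_m(q)\neq\emptyset$. * AxEv: for all $m,k\in\mathrm{IOb}$ and $p\in Q^d$ there is $q\in Q^d$ with $\mathrm{ev}_m(p)=\mathrm{ev}_k(q)$. * AxLinTime: for all $m,k\in\mathrm{IOb}$: $\mathrm{wl}_m(k)=\{w^k_m(o)+\lambda 1^k_m:\lambda\in Q\}$, and $\mathrm{time}_k(\mathrm{ev}_m(p),\mathrm{ev}_m(q))\cdot|1^k_m|=|p-q|$ for all $p,q\in \mathrm{wl}_m(k)$. * AxShift: for all $m,k\in\mathrm{IOb}$ and $p\in Cd_m$ there is $h\in\mathrm{IOb}$ with $h\in\mathrm{ev}_m(p)$ and $1^k_m=1^h_m$. * AxThExp: for all $m\in\mathrm{IOb}$ and $p,q\in Q^d$ with $|p_\sigma-q_\sigma|<|p_\tau-q_\tau|$ there is $k\in\mathrm{IOb}$ with $k\in\mathrm{ev}_m(p)\cap\mathrm{ev}_m(q)$. * SlowTime: for all $m,k\in\mathrm{IOb}$ with $\mathrm{wl}_m(k)\ne \mathrm{wl}_m(m)$: $|(1^k_m)_\tau|>1$. * TwP: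 for all $m,a,b,c\in\mathrm{IOb}$ and $e_a,e,e_c\in Ev_m$ such that $a\in e_a\cap e$, $b\in e_a\cap e_c$, $c\in e\cap e_c$, $b\notin e$, and either $\mathrm{time}_m(e_a)<\mathrm{time}_m(e)<\mathrm{time}_m(e_c)$ or $\mathrm{time}_m(e_a)>\mathrm{time}_m(e)>\mathrm{time}_m(e_c)$, one has $\mathrm{time}_a(e_a,e)+\mathrm{time}_c(e,e_c)<\mathrm{time}_b(e_a,e_c)$. Let $\mathrm{SpecRel}^-_d=\{\mathrm{AxEOF},\mathrm{AxSelf},\mathrm{AxPh},\mathrm{AxEv}\}$. **Theorem.** Let $d\ge3$. 1. Every model of $\mathrm{SpecRel}^-_d+\mathrm{AxLinTime}+\mathrm{SlowTime}$ satisfies TwP. 2. $\mathrm{SpecRel}^-_d+\mathrm{AxShift}+\mathrm{AxLinTime}+\mathrm{AxThExp}+\mathrm{TwP}$ does not imply SlowTime: there is a model of all these axioms in which SlowTime fails and in which, for some observer $m$, the Minkowski sphere $MS^\ddag_m$ is nontrivial and convex and contains a vector $y$ with $|y_\tau|<1$. -/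

import Mathlib

universe u v

/-- A model of the two-sorted language of `d`-dimensional kinematics with photons whose quantity
sort is the ordered field `Q`: the sort `B` of bodies, the unary relations `IOb` (inertial
observers) and `Ph` (photons), and the worldview relation `W m b p`
("observer `m` coordinatizes body `b` at the coordinate point `p`").  The coordinate point
`⟨x₁, …, x_d⟩` is a function `Fin d → Q`; the time coordinate `x₁` has index `0`. -/
structure KinModel (d : ℕ) (Q : Type v) where
  B : Type u
  nonempty_B : Nonempty B
  IOb : B → Prop
  Ph : B → Prop
  W : B → B → (Fin d → Q) → Prop

namespace KinModel

section Quantities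

variable {Q : Type v} [Field Q] [LinearOrder Q]

open Classical in
/-- The nonnegative square root of `x` (and `0` if there is none). -/
noncomputable def qsqrt (x : Q) : Q :=
  if h : ∃ y : Q, 0 ≤ y ∧ y * y = x then Classical.choose h else 0

/-- The length `√(p₁² + … + pₙ²)` of a tuple of quantities. -/
noncomputable def len {ι : Type} [Fintype ι] (p : ι → Q) : Q :=
  qsqrt (∑ i, p i ^ 2)

variable {d : ℕ} [NeZero d]

/-- The time component of a coordinate point. -/
def timeComp (p : Fin d → Q) : Q := p 0

/-- The space component of a coordinate point: all coordinates but the time coordinate. -/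
def spaceComp (p : Fin d → Q) : {i : Fin d // i ≠ 0} → Q := fun i => p i

/-- The point `⟨1, 0, …, 0⟩`. -/
def timeUnit (d : ℕ) [NeZero d] (Q : Type v) [Field Q] : Fin d → Q := Pi.single 0 1

/-- `q` is strictly between the two distinct points `p` and `r`. -/
def Bw (p q r : Fin d → Q) : Prop :=
  p ≠ r ∧ ∃ l : Q, 0 < l ∧ l < 1 ∧ q = l • p + (1 - l) • r

/-- Some multiple `μ q` with `1 < μ` is strictly between `p` and `r`. -/
def Conv (p q r : Fin d → Q) : Prop :=
  ∃ μ : Q, 1 < μ ∧ Bw p (μ • q) r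

/-- Convexity of a set of vectors: whenever some multiple of a member is strictly between two other
members, it is so with a factor greater than `1`. -/
def ConvexSet (H : Set (Fin d → Q)) : Prop :=
  ∀ p ∈ H, ∀ q ∈ H, ∀ r ∈ H, (∃ μ : Q, Bw p (μ • q) r) → Conv p q r

/-- Some positive multiple of a member of `H` is strictly between two members of `H`. -/
def NontrivialSet (H : Set (Fin d → Q)) : Prop :=
  ∃ p ∈ H, ∃ q ∈ H, ∃ r ∈ H, ∃ μ : Q, 0 < μ ∧ Bw p (μ • q) r

open Classical in
/-- `p` if its time component is nonnegative, and `-p` otherwise. -/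
noncomputable def ddag (p : Fin d → Q) : Fin d → Q :=
  if 0 ≤ timeComp p then p else -p

end Quantities

section Notions

variable {d : ℕ} [NeZero d] {Q : Type v} [Field Q] [LinearOrder Q] (M : KinModel.{u, v} d Q)

/-- The event (set of bodies) observed by `m` at `p`. -/
def ev (m : M.B) (p : Fin d → Q) : Set M.B := {b | M.W m b p}

/-- The nonempty events coordinatized by `m`. -/
def Ev (m : M.B) : Set (Set M.B) := {e | e.Nonempty ∧ ∃ p, M.ev m p = e}

/-- The coordinate domain of `m`. -/
def Cd (m : M.B) : Set (Fin d → Q) := {p | (M.ev m p).Nonempty}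

/-- The world-line of body `b` according to `m`. -/
def wl (m b : M.B) : Set (Fin d → Q) := {p | M.W m b p}

/-- "`Crd_m(e)` exists and equals `q`": `q` is the unique point at which `m` observes `e`. -/
def IsCrd (m : M.B) (e : Set M.B) (q : Fin d → Q) : Prop :=
  M.ev m q = e ∧ ∀ q', M.ev m q' = e → q' = q

/-- "`time_m(e)` exists and equals `t`". -/
def IsTime (m : M.B) (e : Set M.B) (t : Q) : Prop :=
  ∃ q, M.IsCrd m e q ∧ t = timeComp q

/-- "The elapsed time `time_m(e₁, e₂)` exists and equals `t`". -/
def IsElapsed (m : M.B) (e₁ e₂ : Set M.B) (t : Q) : Prop :=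
  ∃ t₁ t₂, M.IsTime m e₁ t₁ ∧ M.IsTime m e₂ t₂ ∧ t = |t₁ - t₂|

/-- The worldview transformation between `k` and `m`, as a binary relation. -/
def wRel (k m : M.B) (q p : Fin d → Q) : Prop :=
  q ∈ M.Cd k ∧ p ∈ M.Cd m ∧ M.ev k q = M.ev m p

/-- "The value at `q` of the worldview transformation between `k` and `m` exists and equals `p`":
`p` is the unique point related to `q`. -/
def IsW (k m : M.B) (q p : Fin d → Q) : Prop :=
  M.wRel k m q p ∧ ∀ p', M.wRel k m q p' → p' = p

/-- "The time-unit vector of `k` according to `m` exists and equals `x`". -/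
def IsUnitVec (k m : M.B) (x : Fin d → Q) : Prop :=
  ∃ p₁ p₀, M.IsW k m (timeUnit d Q) p₁ ∧ M.IsW k m 0 p₀ ∧ x = p₁ - p₀

/-- The Minkowski sphere of `m`. -/
def MS (m : M.B) : Set (Fin d → Q) :=
  {y | ∃ k, M.IOb k ∧ ∃ x, M.IsUnitVec k m x ∧ y = ddag x}

/-- `m` observes `a`, `b`, `c` in a twin paradox situation at the events `ea`, `e`, `ec`. -/
def MeetTwP (m a c b : M.B) (ea e ec : Set M.B) : Prop :=
  a ∈ ea ∩ e ∧ b ∈ ea ∩ ec ∧ c ∈ e ∩ ec ∧ b ∉ e ∧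
    ∃ ta t tc, M.IsTime m ea ta ∧ M.IsTime m e t ∧ M.IsTime m ec tc ∧
      ((ta < t ∧ t < tc) ∨ (ta > t ∧ t > tc))

/-- `time_a(ea, e) + time_c(e, ec) < time_b(ea, ec)`. -/
def TimeLt (a c b : M.B) (ea e ec : Set M.B) : Prop :=
  ∃ x y z, M.IsElapsed a ea e x ∧ M.IsElapsed c e ec y ∧ M.IsElapsed b ea ec z ∧ x + y < z

end Notions

section Axioms

variable {d : ℕ} [NeZero d] {Q : Type v} [Field Q] [LinearOrder Q] (M : KinModel.{u, v} d Q)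

/-- The quantities form a Euclidean ordered field: a linearly ordered field in which positive
elements have square roots. -/
def AxEOF (_M : KinModel.{u, v} d Q) : Prop :=
  IsStrictOrderedRing Q ∧ ∀ x : Q, 0 < x → ∃ y : Q, y * y = x

/-- An observer observes itself at a point iff the space component of the point is the origin. -/
def AxSelf : Prop :=
  ∀ m, M.IOb m → ∀ p, M.W m m p ↔ spaceComp p = 0

/-- All observers coordinatize the same events. -/
def AxEv : Prop :=
  ∀ m k, M.IOb m → M.IOb k → ∀ p, ∃ q, M.ev m p = M.ev k q

/-- There is a photon through two points iff their difference has slope `1`. -/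
def AxPh : Prop :=
  ∀ m, M.IOb m → ∀ p q,
    len (spaceComp p - spaceComp q) = |timeComp p - timeComp q| ↔
      ({b | M.Ph b} ∩ M.ev m p ∩ M.ev m q).Nonempty

/-- The axiom system `SpecRel⁻`. -/
def SpecRelMinus : Prop := M.AxEOF ∧ M.AxSelf ∧ M.AxPh ∧ M.AxEv

/-- World-lines of observers are lines and time is elapsing uniformly on them. -/
def AxLinTime : Prop :=
  ∀ m k, M.IOb m → M.IOb k →
    ∃ p₀ x, M.IsW k m 0 p₀ ∧ M.IsUnitVec k m x ∧
      M.wl m k = {p | ∃ l : Q, p = p₀ + l • x} ∧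
      ∀ p ∈ M.wl m k, ∀ q ∈ M.wl m k,
        ∃ t, M.IsElapsed k (M.ev m p) (M.ev m q) t ∧ t * len x = len (p - q)

/-- If `m` observes an observer with a certain time-unit vector, it observes an observer with the
same time-unit vector at each point of its coordinate domain. -/
def AxShift : Prop :=
  ∀ m k, M.IOb m → M.IOb k → ∀ p ∈ M.Cd m,
    ∃ h, M.IOb h ∧ h ∈ M.ev m p ∧ ∃ x, M.IsUnitVec k m x ∧ M.IsUnitVec h m x

/-- Observers can move in any direction at any speed less than `1`. -/
def AxThExp : Prop :=
  ∀ m, M.IOb m → ∀ p q,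
    len (spaceComp p - spaceComp q) < |timeComp p - timeComp q| →
      ∃ k, M.IOb k ∧ k ∈ M.ev m p ∩ M.ev m q

/-- Relatively moving observers' clocks slow down. -/
def SlowTime : Prop :=
  ∀ m k, M.IOb m → M.IOb k → M.wl m k ≠ M.wl m m →
    ∃ x, M.IsUnitVec k m x ∧ |timeComp x| > 1

/-- Every observer observes the twin paradox in every twin paradox situation. -/
def TwP : Prop :=
  ∀ m c a b, M.IOb m → M.IOb c → M.IOb a → M.IOb b →
    ∀ e ∈ M.Ev m, ∀ ea ∈ M.Ev m, ∀ ec ∈ M.Ev m,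
      M.MeetTwP m a c b ea e ec → M.TimeLt a c b ea e ec

end Axioms

end KinModel

/-! Positive part. In the coordinates of the stay-at-home twin `b`, `AxLinTime` makes the elapsed
time of a clock proportional to coordinate time, and `SlowTime` makes it strictly smaller for each
traveller, since neither shares the world-line of `b` (`exists_elapsed_lt`). If `e` is temporally
between `ea` and `ec` for `b`, adding the two strict inequalities gives the claim. The betweenness,
however, is assumed only for `m`. It is transferred without any linearity of worldview
transformations: these are bijections preserving the light relation, and over a Euclidean field with
`d ≥ 3` both timelike relatedness (`tml_iff_light`) and chronological betweenness (`between_equiv`)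
can be detected from that relation.

Counterexample. Over `ℝ`, keep the light cones of Minkowski space but recalibrate the clocks: the
time-unit vectors are the `y` with `⟨y, y⟩ = y₀ + yᵢ / 2 > 0`, the upper sheet of a hyperboloid
centred at time `1/2` and `i`-th coordinate `-1/4`. It passes through the standard time unit, meets
every timelike line through the origin, and dips below height `1`, so some moving clocks do not run
slow. The photon axiom only needs coordinate systems that are Minkowski similarities, so each clock
rate may be prescribed freely. The twin paradox needs only strict convexity of the sheet
(`TiltUnit.add_lt`), which holds because the Minkowski form is negative definite on the kernel of
the tilt functional. -/

namespace KinModel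

/-! ### Minkowski geometry over an ordered field: causal order and betweenness from the light
relation. -/

section Geometry

variable {Q : Type v} [Field Q] [LinearOrder Q] {d : ℕ} [NeZero d]

/-- The Euclidean inner product of the space components. -/
def spaceDot (p q : Fin d → Q) : Q := ∑ i : {i : Fin d // i ≠ 0}, p i * q i

/-- The Minkowski form of signature `(1, d - 1)`. -/
def mdot (p q : Fin d → Q) : Q := p 0 * q 0 - spaceDot p q

omit [LinearOrder Q] in
theorem mdot_comm (p q : Fin d → Q) : mdot p q = mdot q p := by
  simp [mdot, spaceDot, mul_comm]

omit [LinearOrder Q] in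
theorem mdot_add_left (p q r : Fin d → Q) : mdot (p + q) r = mdot p r + mdot q r := by
  simp only [mdot, spaceDot, Pi.add_apply, add_mul, Finset.sum_add_distrib]; ring

omit [LinearOrder Q] in
theorem mdot_smul_left (t : Q) (p r : Fin d → Q) : mdot (t • p) r = t * mdot p r := by
  simp only [mdot, spaceDot, Pi.smul_apply, smul_eq_mul, mul_assoc, mul_sub, Finset.mul_sum]

omit [LinearOrder Q] in
theorem mdot_add_right (p q r : Fin d → Q) : mdot r (p + q) = mdot r p + mdot r q := by
  rw [mdot_comm, mdot_add_left, mdot_comm p, mdot_comm q]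

omit [LinearOrder Q] in
theorem mdot_smul_right (t : Q) (p r : Fin d → Q) : mdot r (t • p) = t * mdot r p := by
  rw [mdot_comm, mdot_smul_left, mdot_comm]

omit [LinearOrder Q] in
theorem mdot_neg_left (p q : Fin d → Q) : mdot (-p) q = -mdot p q := by
  simpa using mdot_smul_left (-1 : Q) p q

omit [LinearOrder Q] in
theorem mdot_neg_right (p q : Fin d → Q) : mdot p (-q) = -mdot p q := by
  simpa using mdot_smul_right (-1 : Q) q p

omit [LinearOrder Q] in
theorem mdot_sub_left (p q r : Fin d → Q) : mdot (p - q) r = mdot p r - mdot q r := by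
  rw [sub_eq_add_neg, mdot_add_left, mdot_neg_left, sub_eq_add_neg]

omit [LinearOrder Q] in
theorem mdot_sub_right (p q r : Fin d → Q) : mdot r (p - q) = mdot r p - mdot r q := by
  rw [sub_eq_add_neg, mdot_add_right, mdot_neg_right, sub_eq_add_neg]

omit [LinearOrder Q] in
theorem mdot_self_sub_comm (p q : Fin d → Q) : mdot (p - q) (p - q) = mdot (q - p) (q - p) := by
  rw [← neg_sub q p, mdot_neg_left, mdot_neg_right, neg_neg]

omit [LinearOrder Q] in
theorem mdot_timeUnit (p : Fin d → Q) : mdot p (timeUnit d Q) = p 0 := by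
  have : spaceDot p (timeUnit d Q) = 0 :=
    Finset.sum_eq_zero fun i _ => by simp [timeUnit, Pi.single_eq_of_ne i.2]
  rw [mdot, this]
  simp [timeUnit]

variable [IsStrictOrderedRing Q]

theorem spaceDot_self_nonneg (p : Fin d → Q) : 0 ≤ spaceDot p p :=
  Finset.sum_nonneg fun _ _ => mul_self_nonneg _

theorem spaceDot_sq_le (p q : Fin d → Q) :
    spaceDot p q ^ 2 ≤ spaceDot p p * spaceDot q q := by
  have := Finset.sum_mul_sq_le_sq_mul_sq Finset.univ
    (fun i : {i : Fin d // i ≠ 0} => p i) (fun i => q i)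
  simpa [spaceDot, sq] using this

theorem sq_le_spaceDot_self (p : Fin d → Q) (i : {i : Fin d // i ≠ 0}) :
    p i ^ 2 ≤ spaceDot p p := by
  rw [sq]
  exact Finset.single_le_sum (f := fun i : {i : Fin d // i ≠ 0} => p i * p i)
    (fun _ _ => mul_self_nonneg _) (Finset.mem_univ i)

theorem eq_zero_of_spaceDot_self {p : Fin d → Q} (h : spaceDot p p = 0) {i : Fin d}
    (hi : i ≠ 0) : p i = 0 := by
  have := sq_le_spaceDot_self p ⟨i, hi⟩
  rw [h] at this
  exact pow_eq_zero_iff two_ne_zero |>.1 (le_antisymm this (sq_nonneg _))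

theorem eq_zero_of_time_of_spaceDot {p : Fin d → Q} (h0 : p 0 = 0) (h : spaceDot p p = 0) :
    p = 0 := by
  funext i
  by_cases hi : i = 0
  · simp [hi, h0]
  · exact eq_zero_of_spaceDot_self h hi

/-- Cauchy–Schwarz for the space components, each of which is no longer than the corresponding time
component. -/
theorem mdot_nonneg_of_causal {p q : Fin d → Q} (hp0 : 0 ≤ p 0) (hp : 0 ≤ mdot p p)
    (hq0 : 0 ≤ q 0) (hq : 0 ≤ mdot q q) : 0 ≤ mdot p q := by
  have h1 := spaceDot_sq_le p q
  have h2 : spaceDot p p * spaceDot q q ≤ (p 0 * p 0) * (q 0 * q 0) :=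
    mul_le_mul (sub_nonneg.1 hp) (sub_nonneg.1 hq) (spaceDot_self_nonneg q) (mul_self_nonneg _)
  exact sub_nonneg.2 ((le_abs_self _).trans
    (abs_le_of_sq_le_sq (by linear_combination h1 + h2) (mul_nonneg hp0 hq0)))

/-- Future directed timelike vectors. -/
def Future (p : Fin d → Q) : Prop := 0 < p 0 ∧ 0 < mdot p p

/-- Future directed causal vectors and the zero vector. -/
def FutureCausal (p : Fin d → Q) : Prop := 0 ≤ p 0 ∧ 0 ≤ mdot p p

omit [IsStrictOrderedRing Q] in
theorem Future.causal {p : Fin d → Q} (h : Future p) : FutureCausal p := ⟨h.1.le, h.2.le⟩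

theorem Future.add_causal {p q : Fin d → Q} (hp : Future p) (hq : FutureCausal q) :
    Future (p + q) := by
  refine ⟨add_pos_of_pos_of_nonneg hp.1 hq.1, ?_⟩
  have := mdot_nonneg_of_causal hp.1.le hp.2.le hq.1 hq.2
  rw [mdot_add_left, mdot_add_right, mdot_add_right, mdot_comm q p]
  linarith [hp.2, hq.2]

theorem Future.smul {p : Fin d → Q} (hp : Future p) {t : Q} (ht : 0 < t) : Future (t • p) :=
  ⟨mul_pos ht hp.1, by
    rw [mdot_smul_left, mdot_smul_right]; exact mul_pos ht (mul_pos ht hp.2)⟩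

theorem time_ne_zero_of_timelike {p : Fin d → Q} (hp : 0 < mdot p p) : p 0 ≠ 0 := fun h => by
  have := spaceDot_self_nonneg p
  rw [mdot, h] at hp
  linarith

theorem Future.trans_causal {p q r : Fin d → Q} (h1 : Future (q - p))
    (h2 : FutureCausal (r - q)) : Future (r - p) := by
  have := h1.add_causal h2
  rwa [add_comm, sub_add_sub_cancel] at this

theorem Future.trans_causal' {p q r : Fin d → Q} (h1 : FutureCausal (q - p))
    (h2 : Future (r - q)) : Future (r - p) := by
  have := h2.add_causal h1
  rwa [sub_add_sub_cancel] at this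

/-- Points at which a common photon is possible. -/
def Light (p q : Fin d → Q) : Prop := mdot (p - q) (p - q) = 0

/-- Timelike related points. -/
def Tml (p q : Fin d → Q) : Prop := 0 < mdot (p - q) (p - q)

omit [LinearOrder Q] [IsStrictOrderedRing Q] in
theorem Light.symm {p q : Fin d → Q} (h : Light p q) : Light q p := by
  rwa [Light, mdot_self_sub_comm]

omit [IsStrictOrderedRing Q] in
theorem Tml.symm {p q : Fin d → Q} (h : Tml p q) : Tml q p := by
  rwa [Tml, mdot_self_sub_comm]

theorem Tml.future {p q : Fin d → Q} (h : Tml p q) (ht : p 0 < q 0) : Future (q - p) :=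
  ⟨sub_pos.2 ht, h.symm⟩

theorem Light.causal {p q : Fin d → Q} (h : Light p q) (ht : p 0 ≤ q 0) :
    FutureCausal (q - p) :=
  ⟨sub_nonneg.2 ht, h.symm.ge⟩

omit [IsStrictOrderedRing Q] in
theorem Future.not_light {p q : Fin d → Q} (h : Future (q - p)) : ¬ Light p q := fun hl =>
  h.2.ne' hl.symm

theorem Tml.time_ne {p q : Fin d → Q} (h : Tml p q) : p 0 ≠ q 0 :=
  fun he => time_ne_zero_of_timelike h (by simp [he])

/-- Orthogonality would turn Cauchy–Schwarz into `v₀² n₀² ≤ |v_σ|² n₀²`, against `|v_σ|² < v₀²` and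
`n₀ ≠ 0`. -/
theorem mdot_null_ne_zero {v n : Fin d → Q} (hv : 0 < mdot v v) (hn : mdot n n = 0)
    (hn0 : n ≠ 0) : mdot v n ≠ 0 := fun h => by
  have h1 := spaceDot_sq_le v n
  have hs : spaceDot n n = n 0 * n 0 := (sub_eq_zero.1 hn).symm
  have hvn : spaceDot v n = v 0 * n 0 := (sub_eq_zero.1 h).symm
  have hv' : spaceDot v v < v 0 * v 0 := sub_pos.1 hv
  have hn00 : n 0 ≠ 0 := fun h0 => hn0 (eq_zero_of_time_of_spaceDot h0 (by rw [hs, h0, zero_mul]))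
  have : 0 < n 0 * n 0 := mul_self_pos.2 hn00
  rw [hs, hvn] at h1
  nlinarith

/-- The light line through `p` and `r` meets the light cone of `q`: along it the null condition `⟨v
- t n, v - t n⟩ = 0` is linear in `t`, because `n` is null, and has nonzero coefficient, because `v`
is timelike. -/
theorem exists_light_light_of_tml {p q r : Fin d → Q} (h : Tml p q) (hr : r ≠ p)
    (hpr : Light p r) : ∃ s, Light p s ∧ Light r s ∧ Light q s := by
  set n := r - p with hn
  set v := q - p with hv
  have hnn : mdot n n = 0 := hpr.symm
  have hvv : 0 < mdot v v := h.symm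
  have hvn := mdot_null_ne_zero hvv hnn (sub_ne_zero.2 hr)
  refine ⟨p + (mdot v v / (2 * mdot v n)) • n, ?_, ?_, ?_⟩
  · rw [Light, sub_add_cancel_left, mdot_neg_left, mdot_neg_right, mdot_smul_left, mdot_smul_right,
      hnn]; simp
  · have : r - (p + (mdot v v / (2 * mdot v n)) • n) = (1 - mdot v v / (2 * mdot v n)) • n := by
      rw [sub_smul, one_smul, hn]; abel
    rw [Light, this, mdot_smul_left, mdot_smul_right, hnn]; simp
  · have : q - (p + (mdot v v / (2 * mdot v n)) • n) = v - (mdot v v / (2 * mdot v n)) • n := by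
      rw [hv]; abel
    rw [Light, this]
    simp only [mdot_sub_left, mdot_sub_right, mdot_smul_left, mdot_smul_right, hnn,
      mdot_comm n v]
    field_simp
    ring

omit [LinearOrder Q] [IsStrictOrderedRing Q] in
theorem spaceDot_eq_of_support (p q : Fin d → Q) {i j : Fin d} (hi : i ≠ 0) (hj : j ≠ 0)
    (hij : i ≠ j) (h : ∀ k, k ≠ 0 → k ≠ i → k ≠ j → p k = 0) :
    spaceDot p q = p i * q i + p j * q j := by
  have hij' : (⟨i, hi⟩ : {i : Fin d // i ≠ 0}) ≠ ⟨j, hj⟩ := fun he => hij (congrArg Subtype.val he)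
  rw [spaceDot, ← Finset.sum_subset (Finset.subset_univ {⟨i, hi⟩, ⟨j, hj⟩}),
    Finset.sum_pair hij']
  intro k _ hk
  simp only [Finset.mem_insert, Finset.mem_singleton, not_or] at hk
  rw [h k k.2 (fun he => hk.1 (Subtype.ext he)) (fun he => hk.2 (Subtype.ext he)), zero_mul]

theorem exists_two_space_indices (hd : 3 ≤ d) :
    ∃ i j : Fin d, i ≠ 0 ∧ j ≠ 0 ∧ i ≠ j := by
  refine ⟨⟨1, by omega⟩, ⟨2, by omega⟩, ?_, ?_, ?_⟩ <;> simp [Fin.ext_iff]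

theorem exists_space_orthogonal (hd : 3 ≤ d) (x : Fin d → Q) :
    ∃ z : Fin d → Q, z 0 = 0 ∧ spaceDot z x = 0 ∧ 0 < spaceDot z z := by
  obtain ⟨i, j, hi, hj, hij⟩ := exists_two_space_indices hd
  by_cases hx : x i = 0 ∧ x j = 0
  · refine ⟨Pi.single i 1, by simp [hi.symm], ?_, ?_⟩ <;>
      rw [spaceDot_eq_of_support _ _ hi hj hij (fun k _ h1 _ => by simp [h1])]
    · simp [hx.1, hij.symm]
    · simp [hij.symm]
  · refine ⟨Pi.single i (x j) - Pi.single j (x i), by simp [hi.symm, hj.symm], ?_, ?_⟩ <;>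
      rw [spaceDot_eq_of_support _ _ hi hj hij (fun k _ h1 h2 => by simp [h1, h2])]
    · simp [hij, hij.symm]; ring
    · simp only [Pi.sub_apply, Pi.single_eq_same, Pi.single_eq_of_ne hij,
        Pi.single_eq_of_ne hij.symm, sub_zero, zero_sub, neg_mul_neg]
      rcases not_and_or.1 hx with h | h
      · exact add_pos_of_nonneg_of_pos (mul_self_nonneg _) (mul_self_pos.2 h)
      · exact add_pos_of_pos_of_nonneg (mul_self_pos.2 h) (mul_self_nonneg _)

theorem exists_null_orthogonal (hsq : ∀ x : Q, 0 < x → ∃ y : Q, y * y = x) (hd : 3 ≤ d)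
    {v : Fin d → Q} (hv : mdot v v < 0) :
    ∃ n : Fin d → Q, n 0 = 1 ∧ mdot n n = 0 ∧ mdot v n = 0 := by
  obtain ⟨z, hz0, hzv, hzz⟩ := exists_space_orthogonal hd v
  set X := spaceDot v v with hX
  set e := timeUnit d Q with he
  have hv' : v 0 * v 0 < X := sub_neg.1 hv
  have hXpos : 0 < X := (mul_self_nonneg _).trans_lt hv'
  have hpos : 0 < (1 - v 0 * v 0 / X) / spaceDot z z :=
    div_pos (sub_pos.2 ((div_lt_one hXpos).2 hv')) hzz
  obtain ⟨b, hb⟩ := hsq _ hpos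
  have hvv : mdot v v = v 0 * v 0 - X := rfl
  have hmzz : mdot z z = - spaceDot z z := by rw [mdot, hz0]; ring
  have hmvz : mdot v z = 0 := by rw [mdot_comm, mdot, hz0, hzv]; ring
  have hee : e 0 = 1 := by simp [he, timeUnit]
  have h1 : ∀ p : Fin d → Q, mdot p e = p 0 := mdot_timeUnit
  have h2 : ∀ p : Fin d → Q, mdot e p = p 0 := fun p => by rw [mdot_comm, h1]
  -- The coefficient `v 0 / X` of `v` makes the vector orthogonal to `v`, that of `e` restores time
  -- component `1`, and the spatial direction `z` orthogonal to `v` supplies the length missing for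
  -- a null vector.
  refine ⟨(1 - v 0 / X * v 0) • e + (v 0 / X) • v + b • z, ?_, ?_, ?_⟩
  · simp only [Pi.add_apply, Pi.smul_apply, smul_eq_mul, hee, hz0]; ring
  · simp only [mdot_add_left, mdot_add_right, mdot_smul_left, mdot_smul_right, h1, h2, hvv, hmzz,
      hmvz, mdot_comm z v, hz0, hee, Pi.add_apply, Pi.smul_apply, smul_eq_mul]
    have hb' : b * (b * spaceDot z z) = 1 - v 0 * v 0 / X := by
      rw [← mul_assoc, hb, div_mul_cancel₀ _ hzz.ne']
    field_simp at hb' ⊢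
    linear_combination - X * hb'
  · simp only [mdot_add_right, mdot_smul_right, h1, hvv, hmvz]
    field_simp
    ring

theorem null_parallel {a n : Fin d → Q} (ha : mdot a a = 0) (hn : mdot n n = 0) (hn0 : n 0 = 1)
    (han : mdot a n = 0) : a = a 0 • n := by
  have h : mdot (a - a 0 • n) (a - a 0 • n) = 0 := by
    simp [mdot_sub_left, mdot_sub_right, mdot_smul_left, mdot_smul_right, mdot_comm n a, ha, hn,
      han]
  have h0 : (a - a 0 • n) 0 = 0 := by simp [hn0]
  refine sub_eq_zero.1 (eq_zero_of_time_of_spaceDot h0 ?_)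
  rw [mdot, h0] at h
  linarith

/-- If `q - p` is spacelike, some null direction `n` is orthogonal to it (this is where `d ≥ 3`
enters). Along the line `p + t n` the form of the difference to `q` is then constant and negative,
so that line misses the light cone of `q`. For timelike `q - p` every light line through `p` meets
it. -/
theorem tml_iff_light (hsq : ∀ x : Q, 0 < x → ∃ y : Q, y * y = x) (hd : 3 ≤ d)
    (p q : Fin d → Q) :
    Tml p q ↔ ¬ Light p q ∧ ∀ r, r ≠ p → Light p r → ∃ s, Light p s ∧ Light r s ∧ Light q s := by
  refine ⟨fun h => ⟨h.ne', fun r hr hpr => exists_light_light_of_tml h hr hpr⟩, ?_⟩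
  rintro ⟨hl, H⟩
  refine (lt_or_gt_of_ne hl).resolve_left fun hneg => ?_
  rw [mdot_self_sub_comm] at hneg
  obtain ⟨n, hn0, hnn, hvn⟩ := exists_null_orthogonal hsq hd hneg
  have hne : n ≠ 0 := fun h => by simp [h] at hn0
  obtain ⟨s, hps, hrs, hqs⟩ := H (p + n) (by simpa using hne) (by
    rw [Light, sub_add_cancel_left, mdot_neg_left, mdot_neg_right, hnn]; simp)
  have ha : mdot (s - p) (s - p) = 0 := hps.symm
  have han : mdot (s - p) n = 0 := by
    have : mdot (s - p - n) (s - p - n) = 0 := by rw [sub_sub]; exact hrs.symm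
    simp only [mdot_sub_left _ n, mdot_sub_right _ n, ha, hnn, mdot_comm n] at this
    linarith
  -- A point light-related to both `p` and `p + n` lies on the line they span.
  have hpar := null_parallel ha hnn hn0 han
  have hvs : mdot (q - p) (s - p) = 0 := by rw [hpar, mdot_smul_right, hvn, mul_zero]
  have : mdot ((q - p) - (s - p)) ((q - p) - (s - p)) = 0 := by
    rw [sub_sub_sub_cancel_right]; exact hqs
  rw [mdot_sub_left _ (s - p), mdot_sub_right _ (s - p), mdot_sub_right _ (s - p),
    mdot_comm (s - p) (q - p), hvs, ha] at this
  linarith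

theorem exists_null (hd : 3 ≤ d) : ∃ n : Fin d → Q, n ≠ 0 ∧ mdot n n = 0 := by
  obtain ⟨i, j, hi, hj, hij⟩ := exists_two_space_indices hd
  refine ⟨Pi.single 0 1 + Pi.single i 1, fun h => ?_, ?_⟩
  · have := congrFun h 0
    simp [hi.symm] at this
  · rw [mdot, spaceDot_eq_of_support _ _ hi hj hij (fun k h0 h1 _ => by simp [h0, h1])]
    simp [hi, hi.symm, hj, hij.symm]

/-- Take `s` on the light cones of both `p` and `r`. Were it in the future of `q`, it would be in
the chronological future of `p`; were it in the past of `q`, it would be in the chronological past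
of `r`. With `between_of_light_spacelike` this characterizes betweenness in terms of relations that
light-preserving bijections respect. -/
theorem exists_light_spacelike_of_between (hd : 3 ≤ d) {p q r : Fin d → Q} (hpq : Future (q - p))
    (hqr : Future (r - q)) :
    ∃ s, Light p s ∧ Light r s ∧ ¬ Tml q s := by
  obtain ⟨n, hn0, hnn⟩ := exists_null (Q := Q) hd
  have hpr : Tml p r := Tml.symm (hpq.trans_causal hqr.causal).2
  obtain ⟨s, hps, -, hrs⟩ := exists_light_light_of_tml (r := p + n) hpr (by simpa using hn0) (by
    rw [Light, sub_add_cancel_left, mdot_neg_left, mdot_neg_right, hnn]; simp)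
  refine ⟨s, hps, hrs, fun h => ?_⟩
  rcases le_total (q 0) (s 0) with ht | ht
  · exact (hpq.trans_causal ⟨sub_nonneg.2 ht, h.symm.le⟩).not_light hps
  · exact (Future.trans_causal' (p := s) ⟨sub_nonneg.2 ht, h.le⟩ hqr).not_light hrs.symm

/-- The point `s` must lie causally between `p` and `r`. If `q` preceded `p` or followed `r`,
composing with these causal relations would make `q` and `s` timelike related. -/
theorem between_of_light_spacelike {p q r s : Fin d → Q} (hpq : Tml p q) (hqr : Tml q r)
    (hpr : Tml p r) (hps : Light p s) (hrs : Light r s) (hqs : ¬ Tml q s)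
    (ht : p 0 < r 0) : p 0 < q 0 ∧ q 0 < r 0 := by
  have hfut := hpr.future ht
  have hp : p 0 ≤ s 0 := le_of_not_gt fun h =>
    (Future.trans_causal' (hps.symm.causal h.le) hfut).not_light hrs.symm
  have hr : s 0 ≤ r 0 := le_of_not_gt fun h =>
    (hfut.trans_causal (hrs.causal h.le)).not_light hps
  constructor
  · refine (lt_or_gt_of_ne hpq.time_ne).resolve_right fun h => hqs ?_
    exact Tml.symm ((hpq.symm.future h).trans_causal (hps.causal hp)).2
  · refine (lt_or_gt_of_ne hqr.time_ne).resolve_right fun h => hqs ?_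
    exact (Future.trans_causal' (hrs.symm.causal hr) (hqr.symm.future h)).2

theorem tml_equiv (hsq : ∀ x : Q, 0 < x → ∃ y : Q, y * y = x) (hd : 3 ≤ d)
    (f : (Fin d → Q) ≃ (Fin d → Q)) (hf : ∀ p q, Light p q ↔ Light (f p) (f q))
    (p q : Fin d → Q) : Tml p q ↔ Tml (f p) (f q) := by
  rw [tml_iff_light hsq hd, tml_iff_light hsq hd, ← hf]
  refine and_congr_right fun _ => ⟨fun H r hr hpr => ?_, fun H r hr hpr => ?_⟩
  · obtain ⟨r, rfl⟩ := f.surjective r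
    obtain ⟨s, hs⟩ := H r (fun h => hr (congrArg f h)) ((hf _ _).2 hpr)
    exact ⟨f s, by simpa only [← hf] using hs⟩
  · obtain ⟨s, hs⟩ := H (f r) (f.injective.ne hr) ((hf _ _).1 hpr)
    obtain ⟨s, rfl⟩ := f.surjective s
    exact ⟨s, by simpa only [← hf] using hs⟩

/-- Light-preserving bijections preserve chronological betweenness. -/
theorem between_equiv (hsq : ∀ x : Q, 0 < x → ∃ y : Q, y * y = x) (hd : 3 ≤ d)
    (f : (Fin d → Q) ≃ (Fin d → Q)) (hf : ∀ p q, Light p q ↔ Light (f p) (f q))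
    {p q r : Fin d → Q} (hpq : Tml p q) (hqr : Tml q r)
    (ht : (p 0 < q 0 ∧ q 0 < r 0) ∨ (r 0 < q 0 ∧ q 0 < p 0)) :
    (f p 0 < f q 0 ∧ f q 0 < f r 0) ∨ (f r 0 < f q 0 ∧ f q 0 < f p 0) := by
  wlog h : p 0 < q 0 ∧ q 0 < r 0 generalizing p r
  · exact (this hqr.symm hpq.symm ht.symm (ht.resolve_left h)).symm
  have hF := tml_equiv hsq hd f hf
  have h1 := hpq.future h.1
  have h2 := hqr.future h.2
  have hpr : Tml p r := Tml.symm (h1.trans_causal h2.causal).2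
  obtain ⟨s, a1, a2, a4⟩ := exists_light_spacelike_of_between hd h1 h2
  rw [hf] at a1 a2
  rw [hF] at a4 hpq hqr hpr
  rcases lt_or_gt_of_ne hpr.time_ne with h' | h'
  · exact Or.inl (between_of_light_spacelike hpq hqr hpr a1 a2 a4 h')
  · exact Or.inr (between_of_light_spacelike hqr.symm hpq.symm hpr.symm a2 a1 a4 h')

end Geometry

/-! ### Euclidean length and its translation into the Minkowski form. -/

section Length

variable {Q : Type v} [Field Q] [LinearOrder Q] [IsStrictOrderedRing Q]

theorem qsqrt_spec (hsq : ∀ x : Q, 0 < x → ∃ y : Q, y * y = x) {x : Q} (hx : 0 ≤ x) :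
    0 ≤ qsqrt x ∧ qsqrt x * qsqrt x = x := by
  have h : ∃ y : Q, 0 ≤ y ∧ y * y = x := by
    rcases hx.eq_or_lt with rfl | hx
    · exact ⟨0, le_rfl, by simp⟩
    · obtain ⟨y, hy⟩ := hsq x hx
      exact ⟨|y|, abs_nonneg y, by rw [abs_mul_abs_self, hy]⟩
  rw [qsqrt, dif_pos h]
  exact Classical.choose_spec h

theorem len_nonneg (hsq : ∀ x : Q, 0 < x → ∃ y : Q, y * y = x) {ι : Type} [Fintype ι]
    (p : ι → Q) : 0 ≤ len p :=
  (qsqrt_spec hsq (Finset.sum_nonneg fun _ _ => sq_nonneg _)).1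

theorem len_sq (hsq : ∀ x : Q, 0 < x → ∃ y : Q, y * y = x) {ι : Type} [Fintype ι]
    (p : ι → Q) : len p ^ 2 = ∑ i, p i ^ 2 := by
  rw [sq]
  exact (qsqrt_spec hsq (Finset.sum_nonneg fun _ _ => sq_nonneg _)).2

theorem len_smul (hsq : ∀ x : Q, 0 < x → ∃ y : Q, y * y = x) {ι : Type} [Fintype ι] (t : Q)
    (p : ι → Q) : len (t • p) = |t| * len p := by
  refine (pow_left_inj₀ (len_nonneg hsq _) (mul_nonneg (abs_nonneg t) (len_nonneg hsq p))
    two_ne_zero).1 ?_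
  rw [mul_pow, len_sq hsq, len_sq hsq, sq_abs, Finset.mul_sum]
  simp [mul_pow]

theorem len_pos (hsq : ∀ x : Q, 0 < x → ∃ y : Q, y * y = x) {ι : Type} [Fintype ι] {p : ι → Q}
    (hp : p ≠ 0) : 0 < len p := by
  refine (len_nonneg hsq p).lt_of_ne fun h => hp (funext fun i => ?_)
  have h1 := len_sq hsq p
  rw [← h, zero_pow two_ne_zero, eq_comm,
    Finset.sum_eq_zero_iff_of_nonneg fun _ _ => sq_nonneg _] at h1
  exact (pow_eq_zero_iff two_ne_zero).1 (h1 i (Finset.mem_univ i))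

variable {d : ℕ} [NeZero d]

theorem len_spaceComp_sq (hsq : ∀ x : Q, 0 < x → ∃ y : Q, y * y = x) (p q : Fin d → Q) :
    len (spaceComp p - spaceComp q) ^ 2 = spaceDot (p - q) (p - q) := by
  rw [len_sq hsq, spaceDot]
  exact Finset.sum_congr rfl fun i _ => by simp [spaceComp, sq]

theorem len_eq_iff_light (hsq : ∀ x : Q, 0 < x → ∃ y : Q, y * y = x) (p q : Fin d → Q) :
    len (spaceComp p - spaceComp q) = |timeComp p - timeComp q| ↔ Light p q := by
  rw [← pow_left_inj₀ (len_nonneg hsq _) (abs_nonneg _) two_ne_zero, len_spaceComp_sq hsq, sq_abs,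
    Light, mdot, sub_eq_zero, eq_comm, sq]
  rfl

theorem len_lt_iff_tml (hsq : ∀ x : Q, 0 < x → ∃ y : Q, y * y = x) (p q : Fin d → Q) :
    len (spaceComp p - spaceComp q) < |timeComp p - timeComp q| ↔ Tml p q := by
  rw [← pow_lt_pow_iff_left₀ (len_nonneg hsq _) (abs_nonneg _) two_ne_zero, len_spaceComp_sq hsq,
    sq_abs, Tml, mdot, sub_pos, sq]
  rfl

end Length

/-! ### Worldview transformations and slow clocks: `SlowTime` implies `TwP`. -/

section Worldviews

variable {Q : Type v} [Field Q] [LinearOrder Q] [IsStrictOrderedRing Q] {d : ℕ} [NeZero d]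
  {M : KinModel.{u, v} d Q}

theorem AxPh.light_iff (hPh : M.AxPh) (hsq : ∀ x : Q, 0 < x → ∃ y : Q, y * y = x) {m : M.B}
    (hm : M.IOb m) (p q : Fin d → Q) :
    Light p q ↔ ({b | M.Ph b} ∩ M.ev m p ∩ M.ev m q).Nonempty := by
  rw [← hPh m hm, len_eq_iff_light hsq]

theorem AxPh.ev_nonempty (hPh : M.AxPh) (hsq : ∀ x : Q, 0 < x → ∃ y : Q, y * y = x) {m : M.B}
    (hm : M.IOb m) (p : Fin d → Q) : (M.ev m p).Nonempty :=
  ((hPh.light_iff hsq hm p p).1 (by simp [Light, mdot, spaceDot])).mono Set.inter_subset_right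

/-- The photons in an event determine the light cone of its point, and a light cone determines its
apex. This supplies the uniqueness behind every coordinate, time and worldview value. -/
theorem AxPh.ev_injective (hPh : M.AxPh) (hsq : ∀ x : Q, 0 < x → ∃ y : Q, y * y = x) {m : M.B}
    (hm : M.IOb m) : Function.Injective (M.ev m) := by
  intro p q h
  have hl : ∀ r, Light p r ↔ Light q r := fun r => by
    rw [hPh.light_iff hsq hm, hPh.light_iff hsq hm, h]
  have hv : mdot (q - p) (q - p) = 0 := (hl p).1 (by simp [Light, mdot, spaceDot])
  set v := q - p with hvdef
  set e := timeUnit d Q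
  -- the spatial reflection of `v` is a null vector as well
  have he : ∀ w : Fin d → Q, mdot w e = w 0 := mdot_timeUnit
  have he' : ∀ w : Fin d → Q, mdot e w = w 0 := fun w => by rw [mdot_comm, he]
  have hee : e 0 = 1 := by simp [e, timeUnit]
  set n := (2 * v 0) • e - v with hn
  have hnn : mdot n n = 0 := by
    simp only [hn, mdot_sub_left, mdot_sub_right, mdot_smul_left, mdot_smul_right, he, he', hee, hv,
      Pi.sub_apply, Pi.smul_apply, smul_eq_mul]
    ring
  have h1 := (hl (p + n)).1 (by
    rw [Light, sub_add_cancel_left, mdot_neg_left, mdot_neg_right, hnn]; simp)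
  have h2 : q - (p + n) = v - n := by rw [hvdef]; abel
  rw [Light, h2] at h1
  simp only [hn, mdot_sub_left, mdot_sub_right, mdot_smul_left, mdot_smul_right, he, he', hee,
    hv, Pi.sub_apply, Pi.smul_apply, smul_eq_mul] at h1
  have hv0 : v 0 = 0 := by
    have : v 0 * v 0 = 0 := by linarith
    exact mul_self_eq_zero.1 this
  have := eq_zero_of_time_of_spaceDot hv0 (by rw [mdot, hv0] at hv; linarith)
  exact (sub_eq_zero.1 this).symm

theorem AxPh.isCrd (hPh : M.AxPh) (hsq : ∀ x : Q, 0 < x → ∃ y : Q, y * y = x) {m : M.B}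
    (hm : M.IOb m) {p : Fin d → Q} {e : Set M.B} (h : M.ev m p = e) : M.IsCrd m e p :=
  ⟨h, fun _ hq => hPh.ev_injective hsq hm (hq.trans h.symm)⟩

theorem AxPh.isElapsed (hPh : M.AxPh) (hsq : ∀ x : Q, 0 < x → ∃ y : Q, y * y = x) {m : M.B}
    (hm : M.IOb m) {p q : Fin d → Q} {e e' : Set M.B} (h : M.ev m p = e) (h' : M.ev m q = e') :
    M.IsElapsed m e e' |p 0 - q 0| :=
  ⟨_, _, ⟨p, hPh.isCrd hsq hm h, rfl⟩, ⟨q, hPh.isCrd hsq hm h', rfl⟩, rfl⟩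

omit [LinearOrder Q] [IsStrictOrderedRing Q] in
theorem IsUnitVec.unique {k m : M.B} {x y : Fin d → Q} (hx : M.IsUnitVec k m x)
    (hy : M.IsUnitVec k m y) : x = y := by
  obtain ⟨p₁, p₀, h₁, h₀, rfl⟩ := hx
  obtain ⟨q₁, q₀, g₁, g₀, rfl⟩ := hy
  rw [h₁.2 _ g₁.1, h₀.2 _ g₀.1]

/-- Worldview transformations are bijections. -/
theorem exists_worldview_equiv (hPh : M.AxPh) (hEv : M.AxEv)
    (hsq : ∀ x : Q, 0 < x → ∃ y : Q, y * y = x) {m k : M.B} (hm : M.IOb m) (hk : M.IOb k) :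
    ∃ f : (Fin d → Q) ≃ (Fin d → Q), (∀ p, M.ev m p = M.ev k (f p)) ∧
      ∀ p q, Light p q ↔ Light (f p) (f q) := by
  choose f hf using hEv m k hm hk
  choose g hg using hEv k m hk hm
  refine ⟨⟨f, g, fun p => hPh.ev_injective hsq hm ?_, fun p => hPh.ev_injective hsq hk ?_⟩, hf,
    fun p q => ?_⟩
  · rw [← hg, ← hf]
  · rw [← hf, ← hg]
  · rw [hPh.light_iff hsq hm, hf p, hf q, Equiv.coe_fn_mk, ← hPh.light_iff hsq hk]

/-- Distinct points on the world-line of an observer are timelike related. -/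
theorem tml_of_mem_wl (hSelf : M.AxSelf) (hPh : M.AxPh) (hEv : M.AxEv)
    (hsq : ∀ x : Q, 0 < x → ∃ y : Q, y * y = x) (hd : 3 ≤ d) {m a : M.B} (hm : M.IOb m)
    (ha : M.IOb a) {p q : Fin d → Q} (hp : a ∈ M.ev m p) (hq : a ∈ M.ev m q) (hpq : p ≠ q) :
    Tml p q := by
  obtain ⟨f, hf, hfl⟩ := exists_worldview_equiv hPh hEv hsq hm ha
  rw [tml_equiv hsq hd f hfl]
  rw [hf] at hp hq
  have hp' := (hSelf a ha _).1 hp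
  have hq' := (hSelf a ha _).1 hq
  have hs : spaceDot (f p - f q) (f p - f q) = 0 :=
    Finset.sum_eq_zero fun i _ => by
      have h1 : f p i = 0 := congrFun hp' i
      have h2 : f q i = 0 := congrFun hq' i
      simp [h1, h2]
  rw [Tml, mdot, hs, sub_zero]
  refine mul_self_pos.2 fun h0 => hpq (f.injective ?_)
  exact sub_eq_zero.1 (eq_zero_of_time_of_spaceDot h0 hs)

/-- A moving clock measures less time than the coordinate time of the observer. -/
theorem exists_elapsed_lt (hsq : ∀ x : Q, 0 < x → ∃ y : Q, y * y = x) (hLin : M.AxLinTime) (hSlow : M.SlowTime)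
    {b a : M.B} (hb : M.IOb b) (ha : M.IOb a) {p q r : Fin d → Q} (hp : a ∈ M.ev b p)
    (hq : a ∈ M.ev b q) (hr : a ∈ M.ev b r) (hbr : b ∉ M.ev b r) (hpq : p ≠ q) :
    ∃ t, M.IsElapsed a (M.ev b p) (M.ev b q) t ∧ t < |p 0 - q 0| := by
  obtain ⟨p₀, x, -, hx, hwl, H⟩ := hLin b a hb ha
  obtain ⟨t, ht, hlen⟩ := H p hp q hq
  refine ⟨t, ht, ?_⟩
  obtain ⟨y, hy, hy1⟩ := hSlow b a hb ha fun h => hbr (h ▸ hr : r ∈ M.wl b b)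
  rw [← hx.unique hy] at hy1
  obtain ⟨l, rfl⟩ : ∃ l : Q, p = p₀ + l • x := by
    have : p ∈ M.wl b a := hp
    rwa [hwl] at this
  obtain ⟨l', rfl⟩ : ∃ l : Q, q = p₀ + l • x := by
    have : q ∈ M.wl b a := hq
    rwa [hwl] at this
  have hx0 : x ≠ 0 := fun h => hpq (by simp [h])
  -- The clock shows `|l - l'|`, while the coordinate time is `|l - l'| * |x 0|` with `|x 0| > 1`.
  have hll : l - l' ≠ 0 := fun h => hpq (by rw [sub_eq_zero.1 h])
  rw [add_sub_add_left_eq_sub, ← sub_smul, len_smul hsq] at hlen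
  have ht' : t = |l - l'| := mul_right_cancel₀ (len_pos hsq hx0).ne' hlen
  have : (p₀ + l • x) 0 - (p₀ + l' • x) 0 = (l - l') * x 0 := by
    simp only [Pi.add_apply, Pi.smul_apply, smul_eq_mul]; ring
  rw [ht', this, abs_mul]
  exact lt_mul_of_one_lt_right (abs_pos.2 hll) hy1

end Worldviews

theorem twP_of_slowTime {Q : Type v} [Field Q] [LinearOrder Q] {d : ℕ} [NeZero d] (hd : 3 ≤ d)
    {M : KinModel.{u, v} d Q} (hM : M.SpecRelMinus) (hLin : M.AxLinTime) (hSlow : M.SlowTime) :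
    M.TwP := by
  obtain ⟨⟨_, hsq⟩, hSelf, hPh, hEv⟩ := hM
  rintro m c a b hm hc ha hb e - ea - ec -
    ⟨⟨haea, hae⟩, ⟨hbea, hbec⟩, ⟨hce, hcec⟩, hbe, ta, t, tc, ⟨p, ⟨rfl, -⟩, rfl⟩, ⟨q, ⟨rfl, -⟩, rfl⟩,
      ⟨r, ⟨rfl, -⟩, rfl⟩, hord⟩
  have hpq : p ≠ q := by rintro rfl; simp at hord
  have hqr : q ≠ r := by rintro rfl; simp at hord
  have tpq := tml_of_mem_wl hSelf hPh hEv hsq hd hm ha haea hae hpq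
  have tqr := tml_of_mem_wl hSelf hPh hEv hsq hd hm hc hce hcec hqr
  obtain ⟨f, hf, hfl⟩ := exists_worldview_equiv hPh hEv hsq hm hb
  have hbet := between_equiv hsq hd f hfl tpq tqr (hord.imp id fun h => ⟨h.2, h.1⟩)
  -- From here on the three events are described in the coordinates of `b`, where `b ∉ e` certifies
  -- that both travellers move.
  rw [hf] at haea hae hbea hbec hce hcec hbe
  rw [hf p, hf q, hf r]
  obtain ⟨x, hx, hx'⟩ := exists_elapsed_lt hsq hLin hSlow hb ha haea hae hae hbe
    (f.injective.ne hpq)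
  obtain ⟨y, hy, hy'⟩ := exists_elapsed_lt hsq hLin hSlow hb hc hce hcec hce hbe
    (f.injective.ne hqr)
  refine ⟨x, y, _, hx, hy, hPh.isElapsed hsq hb rfl rfl, ?_⟩
  rcases hbet with ⟨h1, h2⟩ | ⟨h1, h2⟩
  · rw [abs_of_neg (by linarith)] at hx' hy' ⊢
    linarith
  · rw [abs_of_pos (by linarith)] at hx' hy' ⊢
    linarith

end KinModel

namespace KinModel

/-! ### The tilted hyperboloid: strict convexity and similarities. -/

section TiltedHyperboloid

variable {d : ℕ} [NeZero d]

/-- The linear functional `v ↦ v₀ + vᵢ / 2`. -/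
noncomputable def tilt (i : Fin d) (v : Fin d → ℝ) : ℝ := v 0 + v i / 2

theorem tilt_add (i : Fin d) (v w : Fin d → ℝ) : tilt i (v + w) = tilt i v + tilt i w := by
  simp only [tilt, Pi.add_apply]; ring

theorem tilt_sub (i : Fin d) (v w : Fin d → ℝ) : tilt i (v - w) = tilt i v - tilt i w := by
  simp only [tilt, Pi.sub_apply]; ring

theorem tilt_smul (i : Fin d) (t : ℝ) (v : Fin d → ℝ) : tilt i (t • v) = t * tilt i v := by
  simp only [tilt, Pi.smul_apply, smul_eq_mul]; ring

theorem tilt_timeUnit {i : Fin d} (hi : i ≠ 0) : tilt i (timeUnit d ℝ) = 1 := by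
  simp [tilt, timeUnit, hi]

theorem mdot_timeUnit_self : mdot (timeUnit d ℝ) (timeUnit d ℝ) = 1 := by
  rw [mdot_timeUnit]; simp [timeUnit]

theorem Future.tilt_pos {i : Fin d} (hi : i ≠ 0) {v : Fin d → ℝ} (hv : Future v) :
    0 < tilt i v := by
  have h1 := sq_le_spaceDot_self v ⟨i, hi⟩
  have h2 : spaceDot v v < v 0 * v 0 := sub_pos.1 hv.2
  have h3 : |v i| ≤ v 0 := abs_le_of_sq_le_sq (by simp only at h1; linarith [sq (v 0)]) hv.1.le
  have := neg_le_of_abs_le h3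
  rw [tilt]
  linarith [hv.1]

/-- The functional `tilt i` is the Minkowski product with a timelike vector (time component `1`,
`i`-th component `-1/2`), so its kernel is spacelike. -/
theorem mdot_self_neg_of_tilt_eq_zero {i : Fin d} (hi : i ≠ 0) {v : Fin d → ℝ}
    (hv : tilt i v = 0) (hv0 : v ≠ 0) : mdot v v < 0 := by
  have h1 := sq_le_spaceDot_self v ⟨i, hi⟩
  simp only at h1
  have h0 : v 0 = -(v i / 2) := by rw [tilt] at hv; linarith
  have hpos : 0 < spaceDot v v := by
    refine (spaceDot_self_nonneg v).lt_of_ne fun h => hv0 ?_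
    exact eq_zero_of_time_of_spaceDot (by rw [h0, eq_zero_of_spaceDot_self h.symm hi]; simp) h.symm
  rw [mdot, h0]
  nlinarith

/-- The time-unit vectors of the model below: the upper sheet of a hyperboloid centred off the
origin. -/
def TiltUnit (i : Fin d) (y : Fin d → ℝ) : Prop := mdot y y = tilt i y ∧ 0 < tilt i y

theorem TiltUnit.future {i : Fin d} (hi : i ≠ 0) {y : Fin d → ℝ} (hy : TiltUnit i y) :
    Future y := by
  have hpos : 0 < mdot y y := hy.1 ▸ hy.2
  refine ⟨(lt_or_gt_of_ne (time_ne_zero_of_timelike hpos)).resolve_left fun h => ?_, hpos⟩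
  have hneg : Future (-y) := ⟨neg_pos.2 h, by rwa [mdot_neg_left, mdot_neg_right, neg_neg]⟩
  have := hneg.tilt_pos hi
  rw [← neg_one_smul ℝ y, tilt_smul] at this
  linarith [hy.2]

theorem tiltUnit_timeUnit {i : Fin d} (hi : i ≠ 0) : TiltUnit i (timeUnit d ℝ) := by
  rw [TiltUnit, mdot_timeUnit_self, tilt_timeUnit hi]; simp

theorem exists_smul_tiltUnit {i : Fin d} (hi : i ≠ 0) {v : Fin d → ℝ} (hv : 0 < mdot v v) :
    ∃ (s : ℝ) (y : Fin d → ℝ), TiltUnit i y ∧ v = s • y := by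
  have ht : tilt i v ≠ 0 := fun h =>
    (mdot_self_neg_of_tilt_eq_zero hi h (by rintro rfl; simp [mdot, spaceDot] at hv)).not_gt hv
  -- The equation of the hyperboloid is quadratic on one side and linear on the other, so on the
  -- line through `v` its only nonzero solution is this multiple.
  refine ⟨mdot v v / tilt i v, (tilt i v / mdot v v) • v, ⟨?_, ?_⟩, ?_⟩
  · rw [mdot_smul_left, mdot_smul_right, tilt_smul]
    field_simp
  · rw [tilt_smul, div_mul_eq_mul_div]
    exact div_pos (mul_self_pos.2 ht) hv
  · rw [smul_smul, div_mul_div_cancel₀ ht, div_self hv.ne', one_smul]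

/-- Strict convexity of the hyperboloid of time-unit vectors. -/
theorem TiltUnit.add_lt {i : Fin d} (hi : i ≠ 0) {x y z : Fin d → ℝ} (hx : TiltUnit i x)
    (hy : TiltUnit i y) (hz : TiltUnit i z) (hxy : x ≠ y) {s t r : ℝ} (hs : 0 < s) (ht : 0 < t)
    (h : r • z = s • x + t • y) : s + t < r := by
  have htilt : r * tilt i z = s * tilt i x + t * tilt i y := by
    rw [← tilt_smul, h, tilt_add, tilt_smul, tilt_smul]
  have hm : r * (r * tilt i z) =
      s * (s * tilt i x) + 2 * (s * (t * mdot x y)) + t * (t * tilt i y) := by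
    rw [← hx.1, ← hy.1, ← hz.1, ← mdot_smul_right, ← mdot_smul_left, h]
    simp only [mdot_add_left, mdot_add_right, mdot_smul_left, mdot_smul_right, mdot_comm y x]
    ring
  have hne : tilt i y • x - tilt i x • y ≠ 0 := fun h0 => hxy <| by
    have h1 : tilt i y • x = tilt i x • y := sub_eq_zero.1 h0
    have h2 : mdot (tilt i y • x) (tilt i y • x) = mdot (tilt i x • y) (tilt i x • y) := by rw [h1]
    simp only [mdot_smul_left, mdot_smul_right, hx.1, hy.1] at h2
    have h3 : tilt i y = tilt i x := by
      refine mul_right_cancel₀ (mul_pos hx.2 hy.2).ne' ?_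
      linear_combination h2
    rw [h3] at h1
    exact smul_right_injective _ hx.2.ne' h1
  -- This combination of `x` and `y` is killed by the tilt; its negative square says that `2 ⟨x, y⟩`
  -- exceeds the sum of the tilts. Inserted into the expansion `hm` of `⟨r z, r z⟩`, this bounds `r`
  -- times the total tilt below by `s + t` times it.
  have hlt := mdot_self_neg_of_tilt_eq_zero hi (by
    rw [tilt_sub, tilt_smul, tilt_smul]; ring) hne
  have hB : tilt i x + tilt i y < 2 * mdot x y := by
    have : mdot (tilt i y • x - tilt i x • y) (tilt i y • x - tilt i x • y) =
        tilt i x * tilt i y * (tilt i x + tilt i y - 2 * mdot x y) := by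
      simp only [mdot_sub_left, mdot_sub_right, mdot_smul_left, mdot_smul_right, hx.1, hy.1,
        mdot_comm y x]
      ring
    rw [this] at hlt
    have := (pos_iff_neg_of_mul_neg hlt).1 (mul_pos hx.2 hy.2)
    linarith
  have hpos : 0 < s * tilt i x + t * tilt i y := add_pos (mul_pos hs hx.2) (mul_pos ht hy.2)
  refine lt_of_mul_lt_mul_right (a := s * tilt i x + t * tilt i y) ?_ hpos.le
  rw [htilt] at hm
  rw [hm]
  have := mul_lt_mul_of_pos_left hB (mul_pos hs ht)
  linarith

/-- The Minkowski reflection `v ↦ 2 ⟨v, n⟩ / ⟨n, n⟩ n - v`. -/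
noncomputable def mirror (n : Fin d → ℝ) : (Fin d → ℝ) →ₗ[ℝ] (Fin d → ℝ) where
  toFun v := (2 * mdot v n / mdot n n) • n - v
  map_add' v w := by rw [mdot_add_left, mul_add, add_div, add_smul]; abel
  map_smul' t v := by
    rw [mdot_smul_left, RingHom.id_apply, smul_sub, smul_smul, mul_left_comm, mul_div_assoc]

theorem mirror_apply (n v : Fin d → ℝ) : mirror n v = (2 * mdot v n / mdot n n) • n - v := rfl

theorem mirror_involutive {n : Fin d → ℝ} (hn : mdot n n ≠ 0) :
    Function.Involutive (mirror n) := fun v => by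
  rw [mirror_apply n (mirror n v), mirror_apply n v, mdot_sub_left, mdot_smul_left]
  have : 2 * (2 * mdot v n / mdot n n * mdot n n - mdot v n) / mdot n n =
      2 * mdot v n / mdot n n := by field_simp; ring
  rw [this, sub_sub_cancel]

theorem mdot_mirror {n : Fin d → ℝ} (hn : mdot n n ≠ 0) (v w : Fin d → ℝ) :
    mdot (mirror n v) (mirror n w) = mdot v w := by
  simp only [mirror_apply, mdot_sub_left, mdot_sub_right, mdot_smul_left, mdot_smul_right,
    mdot_comm n w]
  field_simp
  ring

/-- Each future directed vector is the image of the time unit under a Minkowski similarity. -/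
theorem exists_similarity {y : Fin d → ℝ} (hy : Future y) :
    ∃ A : (Fin d → ℝ) ≃ₗ[ℝ] (Fin d → ℝ), A (timeUnit d ℝ) = y ∧
      ∀ v w, mdot (A v) (A w) = mdot y y * mdot v w := by
  have hc : √(mdot y y) ≠ 0 := (Real.sqrt_pos.2 hy.2).ne'
  have hcc : √(mdot y y) * √(mdot y y) = mdot y y := Real.mul_self_sqrt hy.2.le
  set c := √(mdot y y)
  set e := timeUnit d ℝ
  set u := c⁻¹ • y with hu
  have huu : mdot u u = 1 := by
    rw [hu, mdot_smul_left, mdot_smul_right, ← hcc]; field_simp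
  have hu0 : 0 < u 0 := mul_pos (inv_pos.2 (Real.sqrt_pos.2 hy.2)) hy.1
  have hee : mdot e e = 1 := mdot_timeUnit_self
  have hue : mdot u e = u 0 := mdot_timeUnit u
  have hnn : mdot (e + u) (e + u) = 2 * (1 + u 0) := by
    simp only [mdot_add_left, mdot_add_right, hee, hue, huu, mdot_comm e u]; ring
  have hn : mdot (e + u) (e + u) ≠ 0 := by rw [hnn]; positivity
  -- The reflection in the bisector of two unit vectors exchanges them; scaling by `c` then carries
  -- `e` to `y`.
  have hm : mirror (e + u) e = u := by
    have : 2 * mdot e (e + u) / mdot (e + u) (e + u) = 1 := by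
      rw [div_eq_one_iff_eq hn, hnn, mdot_add_right, hee, mdot_comm, hue]
    rw [mirror_apply, this, one_smul, add_sub_cancel_left]
  refine ⟨(LinearEquiv.ofInvolutive (mirror (e + u)) (mirror_involutive hn)).trans
    (LinearEquiv.smulOfNeZero ℝ _ c hc), ?_, fun v w => ?_⟩
  · change c • mirror (e + u) e = y
    rw [hm, hu, smul_inv_smul₀ hc]
  · change mdot (c • mirror (e + u) v) (c • mirror (e + u) w) = _
    rw [mdot_smul_left, mdot_smul_right, mdot_mirror hn, ← mul_assoc, hcc]

end TiltedHyperboloid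

/-! ### The model with tilted clocks, its axioms, and the failure of `SlowTime`. -/

section Model

variable {d : ℕ} [NeZero d]

/-- An inertial coordinate system: an affine Minkowski similarity whose time unit lies on the tilted
hyperboloid. -/
structure Frame (d : ℕ) [NeZero d] (i : Fin d) where
  lin : (Fin d → ℝ) ≃ₗ[ℝ] (Fin d → ℝ)
  origin : Fin d → ℝ
  mdot_lin : ∀ v w, mdot (lin v) (lin w) = tilt i (lin (timeUnit d ℝ)) * mdot v w
  tilt_pos : 0 < tilt i (lin (timeUnit d ℝ))

/-- A parametrized lightlike line. -/
structure LightRay (d : ℕ) [NeZero d] where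
  base : Fin d → ℝ
  dir : Fin d → ℝ
  dir_ne_zero : dir ≠ 0
  null : mdot dir dir = 0

namespace Frame

variable {i : Fin d} (F K : Frame d i)

/-- The time-unit vector of a frame in the reference coordinates. -/
noncomputable def unit : Fin d → ℝ := F.lin (timeUnit d ℝ)

/-- The change from the coordinates of the frame to the reference coordinates. -/
noncomputable def map : (Fin d → ℝ) ≃ (Fin d → ℝ) := F.lin.toEquiv.trans (Equiv.addLeft F.origin)

theorem map_apply (p : Fin d → ℝ) : F.map p = F.origin + F.lin p := rfl

theorem map_sub (p q : Fin d → ℝ) : F.map p - F.map q = F.lin (p - q) := by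
  rw [map_apply, map_apply, _root_.map_sub, add_sub_add_left_eq_sub]

theorem map_add (p v : Fin d → ℝ) : F.map (p + v) = F.map p + F.lin v := by
  rw [map_apply, map_apply, _root_.map_add, add_assoc]

theorem map_smul_timeUnit (t : ℝ) : F.map (t • timeUnit d ℝ) = F.origin + t • F.unit := by
  rw [map_apply, map_smul, unit]

/-- The similarity factor prescribed in `Frame` is chosen for this: evaluated at the time unit, it
is the equation of the hyperboloid. -/
theorem tiltUnit : TiltUnit i F.unit :=
  ⟨by rw [unit, F.mdot_lin, mdot_timeUnit_self, mul_one], F.tilt_pos⟩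

theorem mdot_lin_pos_iff (v : Fin d → ℝ) : 0 < mdot (F.lin v) (F.lin v) ↔ 0 < mdot v v := by
  rw [F.mdot_lin, mul_pos_iff_of_pos_left F.tilt_pos]

theorem light_map_iff (p q : Fin d → ℝ) : Light (F.map p) (F.map q) ↔ Light p q := by
  rw [Light, map_sub, F.mdot_lin, mul_eq_zero, or_iff_right F.tilt_pos.ne', Light]

/-- All frames share one time orientation: the image of `v` has positive product with the unit
vector of the frame, which is future directed. -/
theorem future_lin (hi : i ≠ 0) {v : Fin d → ℝ} (hv : Future v) : Future (F.lin v) := by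
  have hpos := (F.mdot_lin_pos_iff v).2 hv.2
  refine ⟨(lt_or_gt_of_ne (time_ne_zero_of_timelike hpos)).resolve_left fun h => ?_, hpos⟩
  have hu := F.tiltUnit.future hi
  have h1 := mdot_nonneg_of_causal (p := -F.lin v) (neg_nonneg.2 h.le)
    (by rw [mdot_neg_left, mdot_neg_right, neg_neg]; exact hpos.le) hu.1.le hu.2.le
  rw [mdot_neg_left, unit, F.mdot_lin, mdot_timeUnit] at h1
  linarith [mul_pos F.tilt_pos hv.1]

/-- The frame with the reference coordinates. -/
def standard (hi : i ≠ 0) : Frame d i where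
  lin := LinearEquiv.refl ℝ _
  origin := 0
  mdot_lin v w := by simp [tilt_timeUnit hi]
  tilt_pos := by simp [tilt_timeUnit hi]

theorem exists_unit_eq (hi : i ≠ 0) {y : Fin d → ℝ} (hy : TiltUnit i y) (p : Fin d → ℝ) :
    ∃ F : Frame d i, F.unit = y ∧ F.origin = p := by
  obtain ⟨A, hA, hA'⟩ := exists_similarity (hy.future hi)
  exact ⟨⟨A, p, by rwa [hA, ← hy.1], by rw [hA]; exact hy.2⟩, hA, rfl⟩

end Frame

/-- The points of the world-line of a frame or of a light ray, in the reference coordinates. -/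
def track {i : Fin d} : Frame d i ⊕ LightRay d → Set (Fin d → ℝ)
  | .inl F => {x | ∃ t : ℝ, x = F.origin + t • F.unit}
  | .inr l => {x | ∃ t : ℝ, x = l.base + t • l.dir}

/-- The model of special relativity whose clocks tick according to the tilted hyperboloid. -/
def tiltModel {i : Fin d} (hi : i ≠ 0) : KinModel.{0, 0} d ℝ where
  B := Frame d i ⊕ LightRay d
  nonempty_B := ⟨.inl (Frame.standard hi)⟩
  IOb b := ∃ F, b = .inl F
  Ph b := ∃ l, b = .inr l
  W m b p := ∃ F, m = .inl F ∧ F.map p ∈ track b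

variable {i : Fin d} (hi : i ≠ 0)

theorem tiltModel_W (F : Frame d i) (b : Frame d i ⊕ LightRay d) (p : Fin d → ℝ) :
    (tiltModel hi).W (.inl F) b p ↔ F.map p ∈ track b :=
  ⟨fun ⟨_, h, hp⟩ => by rwa [Sum.inl.inj h], fun h => ⟨F, rfl, h⟩⟩

theorem tiltModel_ev (F : Frame d i) (p : Fin d → ℝ) :
    (tiltModel hi).ev (.inl F) p = {b | F.map p ∈ track b} :=
  Set.ext fun _ => tiltModel_W hi F _ p

theorem tiltModel_ev_eq {F K : Frame d i} {p q : Fin d → ℝ} (h : F.map p = K.map q) :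
    (tiltModel hi).ev (.inl F) p = (tiltModel hi).ev (.inl K) q := by
  rw [tiltModel_ev, tiltModel_ev, h]

theorem exists_real_sqrt (x : ℝ) (hx : 0 < x) : ∃ y : ℝ, y * y = x :=
  ⟨√x, Real.mul_self_sqrt hx.le⟩

theorem tiltModel_axSelf : (tiltModel hi).AxSelf := by
  rintro _ ⟨F, rfl⟩ p
  rw [tiltModel_W]
  constructor
  · rintro ⟨t, ht⟩
    rw [← F.map_smul_timeUnit, F.map.injective.eq_iff] at ht
    funext j
    simp [ht, spaceComp, timeUnit, Pi.single_eq_of_ne j.2]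
  · intro h
    refine ⟨p 0, ?_⟩
    rw [← F.map_smul_timeUnit, F.map.injective.eq_iff]
    funext j
    by_cases hj : j = 0
    · simp [hj, timeUnit]
    · have hpj : p j = 0 := congrFun h ⟨j, hj⟩
      simp [timeUnit, hj, hpj]

theorem tiltModel_axPh (hd : 3 ≤ d) : (tiltModel hi).AxPh := by
  rintro _ ⟨F, rfl⟩ p q
  rw [len_eq_iff_light exists_real_sqrt, ← F.light_map_iff, tiltModel_ev, tiltModel_ev]
  constructor
  · intro h
    by_cases hpq : F.map p = F.map q
    -- Coinciding points determine no direction, so an arbitrary null vector serves.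
    · obtain ⟨n, hn, hnn⟩ := exists_null (Q := ℝ) hd
      exact ⟨.inr ⟨F.map p, n, hn, hnn⟩, ⟨⟨_, rfl⟩, 0, by simp⟩, 0, by simp [hpq]⟩
    · exact ⟨.inr ⟨F.map p, F.map q - F.map p, sub_ne_zero.2 (Ne.symm hpq), h.symm⟩,
        ⟨⟨_, rfl⟩, 0, by simp⟩, 1, by simp⟩
  · rintro ⟨_, ⟨⟨l, rfl⟩, t, ht⟩, s, hs⟩
    rw [Light, ht, hs, add_sub_add_left_eq_sub, ← sub_smul, mdot_smul_left, mdot_smul_right, l.null,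
      mul_zero, mul_zero]

theorem tiltModel_axEv : (tiltModel hi).AxEv := by
  rintro _ _ ⟨F, rfl⟩ ⟨K, rfl⟩ p
  exact ⟨K.map.symm (F.map p), tiltModel_ev_eq hi (by simp)⟩

theorem tiltModel_specRelMinus (hd : 3 ≤ d) : (tiltModel hi).SpecRelMinus :=
  ⟨⟨inferInstance, exists_real_sqrt⟩, tiltModel_axSelf hi, tiltModel_axPh hi hd,
    tiltModel_axEv hi⟩

theorem tiltModel_isW (hd : 3 ≤ d) (F K : Frame d i) (q : Fin d → ℝ) :
    (tiltModel hi).IsW (.inl K) (.inl F) q (F.map.symm (K.map q)) := by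
  have hPh := tiltModel_axPh hi hd
  have h : (tiltModel hi).ev (.inl K) q = (tiltModel hi).ev (.inl F) (F.map.symm (K.map q)) :=
    tiltModel_ev_eq hi (by simp)
  exact ⟨⟨hPh.ev_nonempty exists_real_sqrt ⟨K, rfl⟩ q, hPh.ev_nonempty exists_real_sqrt ⟨F, rfl⟩ _,
    h⟩, fun p' hp' => hPh.ev_injective exists_real_sqrt ⟨F, rfl⟩ (hp'.2.2.symm.trans h)⟩

theorem tiltModel_isUnitVec (hd : 3 ≤ d) (F K : Frame d i) :
    (tiltModel hi).IsUnitVec (.inl K) (.inl F) (F.lin.symm K.unit) := by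
  refine ⟨_, _, tiltModel_isW hi hd F K _, tiltModel_isW hi hd F K _, ?_⟩
  rw [LinearEquiv.symm_apply_eq, ← F.map_sub, Equiv.apply_symm_apply, Equiv.apply_symm_apply,
    K.map_sub, sub_zero, Frame.unit]

/-- The parameter along the world-line of `K`, as seen by `F`, is the time shown by the clock of
`K`. -/
theorem map_add_smul_unit (F K : Frame d i) (l : ℝ) :
    F.map (F.map.symm (K.map 0) + l • F.lin.symm K.unit) = K.map (l • timeUnit d ℝ) := by
  rw [F.map_add, Equiv.apply_symm_apply, map_smul, LinearEquiv.apply_symm_apply,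
    K.map_smul_timeUnit, K.map_apply, map_zero, add_zero]

theorem tiltModel_isElapsed (hd : 3 ≤ d) {F K : Frame d i} {p q : Fin d → ℝ} {s t : ℝ}
    (hp : F.map p = K.origin + s • K.unit) (hq : F.map q = K.origin + t • K.unit) :
    (tiltModel hi).IsElapsed (.inl K) ((tiltModel hi).ev (.inl F) p)
      ((tiltModel hi).ev (.inl F) q) |s - t| := by
  rw [← K.map_smul_timeUnit] at hp hq
  have := (tiltModel_axPh hi hd).isElapsed exists_real_sqrt ⟨K, rfl⟩
    (tiltModel_ev_eq hi hp.symm) (tiltModel_ev_eq hi hq.symm)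
  simpa [timeUnit] using this

theorem tiltModel_axLinTime (hd : 3 ≤ d) : (tiltModel hi).AxLinTime := by
  rintro _ _ ⟨F, rfl⟩ ⟨K, rfl⟩
  have hmem : (tiltModel hi).wl (.inl F) (.inl K) =
      {p | ∃ l : ℝ, p = F.map.symm (K.map 0) + l • F.lin.symm K.unit} := by
    ext p
    refine (tiltModel_W hi F _ p).trans (exists_congr fun l => ?_)
    rw [← K.map_smul_timeUnit, ← map_add_smul_unit F, F.map.injective.eq_iff]
  refine ⟨_, _, tiltModel_isW hi hd F K 0, tiltModel_isUnitVec hi hd F K, hmem, ?_⟩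
  rw [hmem]
  rintro _ ⟨l, rfl⟩ _ ⟨l', rfl⟩
  refine ⟨|l - l'|, tiltModel_isElapsed hi hd ?_ ?_, ?_⟩
  · rw [map_add_smul_unit, K.map_smul_timeUnit]
  · rw [map_add_smul_unit, K.map_smul_timeUnit]
  · rw [add_sub_add_left_eq_sub, ← sub_smul, len_smul exists_real_sqrt]

theorem tiltModel_axShift (hd : 3 ≤ d) : (tiltModel hi).AxShift := by
  rintro _ _ ⟨F, rfl⟩ ⟨K, rfl⟩ p -
  refine ⟨.inl ⟨K.lin, F.map p, K.mdot_lin, K.tilt_pos⟩, ⟨_, rfl⟩, ?_, _,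
    tiltModel_isUnitVec hi hd F K, tiltModel_isUnitVec hi hd F _⟩
  rw [tiltModel_ev]
  exact ⟨0, by simp⟩

theorem tiltModel_axThExp : (tiltModel hi).AxThExp := by
  rintro _ ⟨F, rfl⟩ p q h
  rw [len_lt_iff_tml exists_real_sqrt] at h
  obtain ⟨s, y, hy, hs⟩ := exists_smul_tiltUnit hi ((F.mdot_lin_pos_iff _).2 h.symm)
  obtain ⟨K, hK, hK0⟩ := Frame.exists_unit_eq hi hy (F.map p)
  refine ⟨.inl K, ⟨K, rfl⟩, ?_⟩
  rw [tiltModel_ev, tiltModel_ev]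
  refine ⟨⟨0, by simp [hK0]⟩, s, ?_⟩
  rw [hK0, hK, ← hs, ← F.map_sub, add_sub_cancel]

/-- The twin paradox for the inertial motions through the events `p`, `q`, `r`. -/
theorem twin_add_lt (hi : i ≠ 0) {a b c p q r : Fin d → ℝ} (ha : TiltUnit i a) (hb : TiltUnit i b)
    (hc : TiltUnit i c) {s t l : ℝ} (hpq : q - p = s • a) (hqr : r - q = t • c)
    (hpr : r - p = l • b) (hfpq : Future (q - p)) (hfqr : Future (r - q))
    (hq : ∀ x : ℝ, q ≠ p + x • b) : s + t < l := by
  have hs : 0 < s := by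
    have := hfpq.tilt_pos hi
    rw [hpq, tilt_smul] at this
    exact pos_of_mul_pos_left this ha.2.le
  have ht : 0 < t := by
    have := hfqr.tilt_pos hi
    rw [hqr, tilt_smul] at this
    exact pos_of_mul_pos_left this hc.2.le
  have hsum : l • b = s • a + t • c := by rw [← hpq, ← hqr, ← hpr]; abel
  refine ha.add_lt hi hc hb ?_ hs ht hsum
  -- If both travellers have the same unit vector, the path from `p` through `q` to `r` is straight
  -- and `q` lies on the line of `b`; the factor below locates it there.
  rintro rfl
  refine hq (s * (s + t)⁻¹ * l) ?_
  rw [mul_smul, hsum, ← add_smul, smul_smul, mul_assoc, inv_mul_cancel₀ (add_pos hs ht).ne',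
    mul_one, ← hpq, add_sub_cancel]

theorem tiltModel_twP (hd : 3 ≤ d) : (tiltModel hi).TwP := by
  rintro _ _ _ _ ⟨F, rfl⟩ ⟨c, rfl⟩ ⟨a, rfl⟩ ⟨b, rfl⟩ _ - _ - _ -
    ⟨⟨hap, haq⟩, ⟨hbp, hbr⟩, ⟨hcq, hcr⟩, hbq, _, _, _, ⟨p, ⟨rfl, -⟩, rfl⟩, ⟨q, ⟨rfl, -⟩, rfl⟩,
      ⟨r, ⟨rfl, -⟩, rfl⟩, hord⟩
  rw [tiltModel_ev] at hap haq hbp hbr hcq hcr hbq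
  obtain ⟨a₁, hap⟩ := hap
  obtain ⟨a₂, haq⟩ := haq
  obtain ⟨b₁, hbp⟩ := hbp
  obtain ⟨b₂, hbr⟩ := hbr
  obtain ⟨c₁, hcq⟩ := hcq
  obtain ⟨c₂, hcr⟩ := hcr
  have hbq' : ∀ t : ℝ, F.map q ≠ b.origin + t • b.unit := fun t h => hbq ⟨t, h⟩
  refine ⟨_, _, _, tiltModel_isElapsed hi hd hap haq, tiltModel_isElapsed hi hd hcq hcr,
    tiltModel_isElapsed hi hd hbp hbr, ?_⟩
  -- the time order seen by `F` is the time order of the reference coordinates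
  have key : ∀ (k : Frame d i) (x y : Fin d → ℝ) (s t : ℝ), F.map x = k.origin + s • k.unit →
      F.map y = k.origin + t • k.unit → x 0 < y 0 → Future (F.map y - F.map x) := by
    intro k x y s t hx hy hxy
    rw [F.map_sub]
    refine F.future_lin hi ⟨sub_pos.2 hxy, (F.mdot_lin_pos_iff _).1 ?_⟩
    have hst : t - s ≠ 0 := fun h => hxy.ne (by
      rw [F.map.injective (hx.trans (by rw [hy, sub_eq_zero.1 h]))])
    rw [← F.map_sub, hx, hy, add_sub_add_left_eq_sub, ← sub_smul, mdot_smul_left, mdot_smul_right,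
      ← mul_assoc]
    exact mul_pos (mul_self_pos.2 hst) (k.tiltUnit.future hi).2
  have hdiff : ∀ {k : Frame d i} {x y : Fin d → ℝ} {s t : ℝ}, x = k.origin + s • k.unit →
      y = k.origin + t • k.unit → y - x = (t - s) • k.unit := by
    rintro k _ _ s t rfl rfl
    rw [add_sub_add_left_eq_sub, ← sub_smul]
  have hpos : ∀ {k : Frame d i} {x : Fin d → ℝ} {s : ℝ}, x = s • k.unit → Future x → 0 < s := by
    rintro k _ s rfl h
    have := h.tilt_pos hi
    rw [tilt_smul] at this
    exact pos_of_mul_pos_left this k.tilt_pos.le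
  rcases hord with ⟨h1, h2⟩ | ⟨h1, h2⟩
  · have f1 := key a p q _ _ hap haq h1
    have f2 := key c q r _ _ hcq hcr h2
    have hlt := twin_add_lt hi a.tiltUnit b.tiltUnit c.tiltUnit (hdiff hap haq) (hdiff hcq hcr)
      (hdiff hbp hbr) f1 f2 fun x hx => hbq' (b₁ + x) (by rw [hx, hbp, add_assoc, ← add_smul])
    have g1 := hpos (hdiff hap haq) f1
    have g2 := hpos (hdiff hcq hcr) f2
    rw [abs_sub_comm a₁, abs_sub_comm c₁, abs_sub_comm b₁, abs_of_pos g1, abs_of_pos g2]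
    exact hlt.trans_le (le_abs_self _)
  · have f1 := key a q p _ _ haq hap h1
    have f2 := key c r q _ _ hcr hcq h2
    have hlt := twin_add_lt hi c.tiltUnit b.tiltUnit a.tiltUnit (hdiff hcr hcq) (hdiff haq hap)
      (hdiff hbr hbp) f2 f1 fun x hx => hbq' (b₂ + x) (by rw [hx, hbr, add_assoc, ← add_smul])
    have g1 := hpos (hdiff haq hap) f1
    have g2 := hpos (hdiff hcr hcq) f2
    rw [abs_of_pos g1, abs_of_pos g2, add_comm]
    exact hlt.trans_le (le_abs_self _)

theorem tiltModel_MS (hd : 3 ≤ d) :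
    (tiltModel hi).MS (.inl (Frame.standard hi)) = {y | TiltUnit i y} := by
  have hdd : ∀ K : Frame d i, ddag K.unit = K.unit := fun K =>
    if_pos (K.tiltUnit.future hi).1.le
  ext y
  constructor
  · rintro ⟨_, ⟨K, rfl⟩, x, hx, rfl⟩
    rw [hx.unique (tiltModel_isUnitVec hi hd _ K)]
    change TiltUnit i (ddag K.unit)
    rw [hdd]
    exact K.tiltUnit
  · intro hy
    obtain ⟨K, rfl, -⟩ := Frame.exists_unit_eq hi hy 0
    exact ⟨.inl K, ⟨K, rfl⟩, _, tiltModel_isUnitVec hi hd _ K, (hdd K).symm⟩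

theorem exists_tiltUnit_time_lt_one (hi : i ≠ 0) {j : Fin d} (hj : j ≠ 0) (hij : i ≠ j) :
    ∃ y : Fin d → ℝ, TiltUnit i y ∧ y 0 = 14 / 15 := by
  -- In the direction with velocity `w` along axis `i`, the unit vector has height `(1 + w / 2) / (1
  -- - w²)`, which is below `1` exactly for `-1/2 < w < 0` among the speeds less than `1`. The
  -- choice `w = -1/4` gives `14 / 15`.
  refine ⟨Pi.single 0 (14 / 15) - Pi.single i (7 / 30), ?_, by simp [hi.symm]⟩
  rw [TiltUnit, mdot, tilt, spaceDot_eq_of_support _ _ hi hj hij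
    (fun k h0 h1 _ => by simp [h0, h1])]
  simp [hi, hi.symm, hj, hij.symm]
  norm_num

theorem tiltModel_not_slowTime (hd : 3 ≤ d) {y : Fin d → ℝ} (hy : TiltUnit i y)
    (h0 : y 0 = 14 / 15) : ¬ (tiltModel hi).SlowTime := by
  intro hS
  obtain ⟨K, hK, hK0⟩ := Frame.exists_unit_eq hi hy 0
  obtain ⟨x, hx, hx1⟩ := hS (.inl (Frame.standard hi)) (.inl K) ⟨_, rfl⟩ ⟨_, rfl⟩ fun hwl => by
    have hmem : y ∈ (tiltModel hi).wl (.inl (Frame.standard hi)) (.inl K) := by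
      refine (tiltModel_W hi _ _ _).2 ⟨1, ?_⟩
      rw [hK, hK0, one_smul]
      rfl
    rw [hwl] at hmem
    have hs := (tiltModel_axSelf hi _ ⟨_, rfl⟩ y).1 hmem
    have hyi : y i = 0 := congrFun hs ⟨i, hi⟩
    have hss : spaceDot y y = 0 := Finset.sum_eq_zero fun j _ => by
      rw [show y j = 0 from congrFun hs j, zero_mul]
    -- On the time axis the hyperboloid equation reads `y₀² = y₀`, which `14 / 15` does not satisfy.
    have := hy.1
    rw [mdot, tilt, hss, h0, hyi] at this
    norm_num at this
  rw [hx.unique (tiltModel_isUnitVec hi hd _ K)] at hx1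
  change |K.unit 0| > 1 at hx1
  rw [hK, h0, abs_of_pos (by norm_num)] at hx1
  norm_num at hx1

/-- The coefficients `l` and `1 - l` sum to `1`, so `TiltUnit.add_lt` shows that the given factor
itself exceeds `1`. -/
theorem convexSet_tiltUnit (hi : i ≠ 0) : ConvexSet {y | TiltUnit i y} := by
  rintro p hp q hq r hr ⟨μ, hpr, l, h0, h1, hl⟩
  refine ⟨μ, ?_, hpr, l, h0, h1, hl⟩
  have := hp.add_lt hi hr hq hpr h0 (sub_pos.2 h1) hl
  linarith

theorem nontrivialSet_tiltUnit (hi : i ≠ 0) {p r : Fin d → ℝ} (hp : TiltUnit i p) (hr : TiltUnit i r)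
    (hpr : p ≠ r) : NontrivialSet {y | TiltUnit i y} := by
  have hf : Future ((1 / 2 : ℝ) • p + (1 - 1 / 2 : ℝ) • r) :=
    ((hp.future hi).smul (by norm_num)).add_causal ((hr.future hi).smul (by norm_num)).causal
  obtain ⟨s, q, hq, hs⟩ := exists_smul_tiltUnit hi hf.2
  have ht := hf.tilt_pos hi
  rw [hs, tilt_smul] at ht
  exact ⟨p, hp, q, hq, r, hr, s, pos_of_mul_pos_left ht hq.2.le, hpr, 1 / 2, by norm_num,
    by norm_num, hs.symm⟩

end Model

end KinModel

theorem theorem5p3 (d : ℕ) [NeZero d] (hd : 3 ≤ d) :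
    (∀ (Q : Type v) [Field Q] [LinearOrder Q] (M : KinModel.{u, v} d Q),
      M.SpecRelMinus → M.AxLinTime → M.SlowTime → M.TwP) ∧
    (∃ (Q : Type) (_ : Field Q) (_ : LinearOrder Q) (M : KinModel.{0, 0} d Q),
      M.SpecRelMinus ∧ M.AxShift ∧ M.AxLinTime ∧ M.AxThExp ∧ M.TwP ∧ ¬ M.SlowTime ∧
      ∃ m, M.IOb m ∧ KinModel.NontrivialSet (M.MS m) ∧ KinModel.ConvexSet (M.MS m) ∧
        ∃ y ∈ M.MS m, |KinModel.timeComp y| < 1) := by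
  refine ⟨fun Q _ _ M hM hLin hSlow => KinModel.twP_of_slowTime hd hM hLin hSlow, ?_⟩
  obtain ⟨i, j, hi, hj, hij⟩ := KinModel.exists_two_space_indices hd
  obtain ⟨y, hy, hy0⟩ := KinModel.exists_tiltUnit_time_lt_one hi hj hij
  refine ⟨ℝ, inferInstance, inferInstance, KinModel.tiltModel hi,
    KinModel.tiltModel_specRelMinus hi hd, KinModel.tiltModel_axShift hi hd,
    KinModel.tiltModel_axLinTime hi hd, KinModel.tiltModel_axThExp hi, KinModel.tiltModel_twP hi hd,
    KinModel.tiltModel_not_slowTime hi hd hy hy0, .inl (KinModel.Frame.standard hi), ⟨_, rfl⟩, ?_⟩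
  rw [KinModel.tiltModel_MS hi hd]
  refine ⟨KinModel.nontrivialSet_tiltUnit hi (KinModel.tiltUnit_timeUnit hi) hy fun h => ?_,
    KinModel.convexSet_tiltUnit hi, y, hy, ?_⟩
  · rw [← h] at hy0
    norm_num [KinModel.timeUnit] at hy0
  · rw [KinModel.timeComp, hy0, abs_of_pos (by norm_num)]
    norm_num
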